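/- **Theorem 1.6.** Let $c_1(x),c_2(x),f_1(x),f_2(x)\in\mathbb{Q}[x]$ be non-zero polynomials and for every positive integer $n$ put $$u_n(x)=c_1(x)f_1(x)^n+c_2(x)f_2(x)^n .$$ For $g_1,g_2\in\mathbb{Q}[x]$, not both zero, let $\mathrm{h}(g_1,g_2)=\log\max_i|a_i|$, where $(a_i)$ is a vector of integers with greatest common divisor $1$ that is proportional, by a non-zero rational factor, to the vector of all coefficients of $g_1$ and $g_2$. Set $$D=\max\{\deg c_1,\deg c_2,\deg f_1,\deg f_2\},\qquad X=\max\{3,\mathrm{h}(c_1,c_2),\mathrm{h}(f_1,f_2)\}.$$ Let $m\ge 3$ be an integer, and let $Z$ be either the set of all complex $m$-th roots of unity or the set of all primitive ones. Let $S$ be the set of positive integers $n$ such that $u_n(x)$ is not identically zero but $u_n(\zeta)=0$ for some $\zeta\in Z$. Assume that $S$ is not empty. Then the smallest element $n$ of $S$ satisfies $$n\le m(\log m)^3(X+\log D).$$ More precisely, at least one of the following holds: 1. there exists $n\in S$ with $n\le 2m$; 2. every $n\in S$ satisfies $n\le m(\log m)^3(X+\log D)$; 3. $m$ is odd, and there is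 a positive integer $k\le 2m$ such that $u_k(x)$ is identically zero and $2m+k\in S$. In particular, if $m$ is even, or if no $u_k(x)$ with $1\le k\le 2m$ is identically zero, then 1 or 2 holds. -/

import Mathlib

open Polynomial

/-- The polynomial `u_n(x) = c₁(x) f₁(x)^n + c₂(x) f₂(x)^n`. -/
noncomputable def powerSum (c₁ c₂ f₁ f₂ : ℚ[X]) (n : ℕ) : ℚ[X] :=
  c₁ * f₁ ^ n + c₂ * f₂ ^ n

/-- The vector formed of all the coefficients of the two polynomials `g₁` and `g₂`. -/
def coeffVector (g₁ g₂ : ℚ[X]) :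
    Fin (g₁.natDegree + 1) ⊕ Fin (g₂.natDegree + 1) → ℚ :=
  Sum.elim (fun i => g₁.coeff i) (fun j => g₂.coeff j)

/-- The (projective, logarithmic) height `h(g₁, g₂)` of a pair of polynomials over `ℚ`:
the height of the vector of all their coefficients. -/
noncomputable def pairHeight (g₁ g₂ : ℚ[X]) : ℝ :=
  Height.logHeight (coeffVector g₁ g₂)

/-- If the coefficient vector is a nonzero rational multiple of a primitive integer vector `a`,
then the height is `log max |a_i|`. -/
theorem pairHeight_eq_log_max (g₁ g₂ : ℚ[X]) (t : ℚ) (ht : t ≠ 0)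
    (a : Fin (g₁.natDegree + 1) ⊕ Fin (g₂.natDegree + 1) → ℤ)
    (ha : Finset.univ.gcd a = 1) (h : ∀ i, coeffVector g₁ g₂ i = t * (a i : ℚ)) :
    pairHeight g₁ g₂ = Real.log ((⨆ i, |a i| : ℤ) : ℝ) := by
  have hv : coeffVector g₁ g₂ = t • fun i => (a i : ℚ) := by
    funext i
    simp [h i]
  rw [pairHeight, hv, Height.logHeight_smul_eq_logHeight _ ht]
  exact Rat.logHeight_eq_max_abs_of_gcd_eq_one ha

/-- `D`, the maximum of the degrees of the four polynomials. -/
noncomputable def maxDegree (c₁ c₂ f₁ f₂ : ℚ[X]) : ℕ :=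
  max (max c₁.natDegree c₂.natDegree) (max f₁.natDegree f₂.natDegree)

/-- `X = max {3, h(c₁, c₂), h(f₁, f₂)}`. -/
noncomputable def heightParam (c₁ c₂ f₁ f₂ : ℚ[X]) : ℝ :=
  max 3 (max (pairHeight c₁ c₂) (pairHeight f₁ f₂))

/-- The set of positive integers `n` such that `u_n` is not identically zero but vanishes
at some element of `Z`. -/
def vanishingSet (c₁ c₂ f₁ f₂ : ℚ[X]) (Z : Set ℂ) : Set ℕ :=
  {n | 1 ≤ n ∧ powerSum c₁ c₂ f₁ f₂ n ≠ 0 ∧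
    ∃ ζ ∈ Z, aeval ζ (powerSum c₁ c₂ f₁ f₂ n) = 0}

/-- The quantity `m (log m)³ (X + log D)`. -/
noncomputable def indexBound (c₁ c₂ f₁ f₂ : ℚ[X]) (m : ℕ) : ℝ :=
  (m : ℝ) * Real.log m ^ 3 *
    (heightParam c₁ c₂ f₁ f₂ + Real.log (maxDegree c₁ c₂ f₁ f₂))

/-!
Let `n` be an index at which `u_n` vanishes at an `m`-th root of unity `ζ`, and work in the
cyclotomic field `K = ℚ(ζ_m)`. If one of `c₁, c₂, f₁, f₂` vanishes at `ζ`, then every `u_k` does,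
and one of `u_1, u_2` is not identically zero (two consecutive zero polynomials force `f₁ = f₂`, and
then all `u_k` are zero). Otherwise put `x = f₂(ζ) / f₁(ζ)`, so that `x ^ n = -c₁(ζ) / c₂(ζ)`.

If `x` is a root of unity, it is a `2m`-th root of unity, even an `m`-th one when `m` is even
(`IsCyclotomicExtension.pow_eq_one_of_pow_eq_one`). Hence the vanishing of `u_k(ζ)` depends only on
`k` modulo this order `N`, and `n` may be replaced by its residue `k ∈ [1, N]`, or by `N + k` when
`u_k` is identically zero (`exists_mem_vanishingSet_of_forall_add_mul`).

If `x` is not a root of unity, compare heights: `n h(x) = h(c₁(ζ) / c₂(ζ))`. The right side is at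
most `[K : ℚ] (h(c₁, c₂) + log (D + 1))` (`logHeight₁_aeval_div_aeval_le`), and `h(x)` is bounded
below by the method of Amoroso and Dvornicich. For a prime `p` not dividing `m`, the Frobenius `σ` of
`K` at `p` satisfies `a ^ p ≡ σ a` modulo `p` for every integer `a` of `K`. Thus `x ^ p - σ x` is
divisible by `p` up to the denominators of `x` and `σ x`. If it is zero, `x` is a root of unity;
if not, the product formula and `h(σ x) = h(x)` give `(p + 1) h(x) ≥ [K : ℚ] log (p / 2)`
(`IsCyclotomicExtension.log_le_logHeight₁`). For `m ≥ 5` an odd prime factor of `m - 1` or `m - 2`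
serves as `p`. For `m = 3, 4` the field is imaginary quadratic, and an element of multiplicative
height less than `2` is a unit, hence a root of unity.

The bound for the smallest element follows by comparing `2m` and `4m` with `m (log m)³ (X + log D)`.
The only case not covered by the numerical comparison is `m = 3`, `D ≤ 1` and `k = 2m = 6`, where
`u_6 = 0` forces `f₁` and `f₂` to be proportional.
-/

/-! ### Heights of conjugates, roots of unity and elements of small height -/

open NumberField Height

theorem Ideal.absNorm_map_ringEquiv {R : Type*} [CommRing R] [IsDedekindDomain R]
    [Module.Free ℤ R] (e : R ≃+* R) (I : Ideal R) :
    Ideal.absNorm (I.map e) = Ideal.absNorm I := by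
  rw [Ideal.absNorm_apply, Ideal.absNorm_apply, Submodule.cardQuot_apply,
    Submodule.cardQuot_apply]
  exact Nat.card_congr (Ideal.quotientEquiv I (I.map e) e rfl).symm.toEquiv

section NumberField

variable {K : Type*} [Field K] [NumberField K]

/-- The finite part of the height of a tuple of integers is the inverse norm of the ideal which they
generate. -/
theorem NumberField.mulHeight_mul_absNorm {ι : Type*} [Finite ι] {x : ι → 𝓞 K} (hx : x ≠ 0) :
    mulHeight (fun i => (x i : K)) * (Ideal.span (Set.range x)).absNorm =
      ∏ v : InfinitePlace K, (⨆ i, v (x i)) ^ v.mult := by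
  have hx' : (fun i => (x i : K)) ≠ 0 := by
    obtain ⟨i, hi⟩ := Function.ne_iff.mp hx
    exact Function.ne_iff.mpr ⟨i, by simpa using hi⟩
  rw [NumberField.mulHeight_eq hx', mul_assoc,
    mul_comm (finprod _), absNorm_mul_finprod_finitePlace_eq_one hx, mul_one]

theorem NumberField.mulHeight_algEquiv_comp {ι : Type*} [Finite ι] (σ : K ≃ₐ[ℚ] K)
    {x : ι → 𝓞 K} (hx : x ≠ 0) :
    mulHeight (fun i => σ (x i : K)) = mulHeight (fun i => (x i : K)) := by
  let e : 𝓞 K ≃+* 𝓞 K := RingOfIntegers.mapRingEquiv (σ : K ≃+* K)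
  have hex : (fun i => e (x i)) ≠ 0 := by
    obtain ⟨i, hi⟩ := Function.ne_iff.mp hx
    exact Function.ne_iff.mpr ⟨i, by simpa using hi⟩
  have hspan : Ideal.span (Set.range fun i => e (x i)) = (Ideal.span (Set.range x)).map e := by
    rw [Ideal.map_span, ← Set.range_comp]
    rfl
  have h1 := NumberField.mulHeight_mul_absNorm hex
  have h2 := NumberField.mulHeight_mul_absNorm hx
  rw [hspan, Ideal.absNorm_map_ringEquiv] at h1
  have hprod : ∏ v : InfinitePlace K, (⨆ i, v (e (x i) : K)) ^ v.mult =
      ∏ v : InfinitePlace K, (⨆ i, v (x i)) ^ v.mult := by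
    refine Fintype.prod_equiv (MulAction.toPerm σ⁻¹) _ _ fun v => ?_
    have hmult : (σ⁻¹ • v).mult = v.mult := by
      classical
      unfold InfinitePlace.mult
      exact if_congr InfinitePlace.isReal_smul_iff rfl rfl
    rw [MulAction.toPerm_apply, hmult]
    congr 1
  rw [hprod, ← h2] at h1
  have hne : ((Ideal.span (Set.range x)).absNorm : ℝ) ≠ 0 := by
    rw [Nat.cast_ne_zero, Ne, Ideal.absNorm_eq_zero_iff]
    obtain ⟨i, hi⟩ := Function.ne_iff.mp hx
    intro h
    exact hi (Ideal.span_eq_bot.mp h _ ⟨i, rfl⟩)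
  exact mul_right_cancel₀ hne h1

theorem NumberField.mulHeight₁_algEquiv (σ : K ≃ₐ[ℚ] K) (x : K) :
    mulHeight₁ (σ x) = mulHeight₁ x := by
  obtain ⟨a, b, hb, rfl⟩ := IsFractionRing.div_surjective (𝓞 K) x
  have hb' : b ≠ 0 := nonZeroDivisors.ne_zero hb
  have hne : ![a, b] ≠ 0 := by
    intro h
    exact hb' (congrFun h 1)
  have h := NumberField.mulHeight_algEquiv_comp σ hne
  rw [map_div₀, mulHeight₁_div_eq_mulHeight, mulHeight₁_div_eq_mulHeight]
  convert h using 2 <;> · ext i; fin_cases i <;> rfl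

/-- The product formula for a positive integer `p`, all of whose archimedean absolute values are `p`. -/
theorem NumberField.prod_finitePlace_natCast {p : ℕ} (hp : p ≠ 0) :
    (p : ℝ) ^ Module.finrank ℚ K * ∏ᶠ v : FinitePlace K, v (p : K) = 1 := by
  have h := prod_abs_eq_one (K := K) (x := (p : K)) (by exact_mod_cast hp)
  have h2 : ∏ w : InfinitePlace K, w (p : K) ^ w.mult = (p : ℝ) ^ Module.finrank ℚ K := by
    rw [← InfinitePlace.sum_mult_eq, ← Finset.prod_pow_eq_pow_sum]
    simp
  rwa [h2] at h

/-- Such an element and its inverse have denominator less than `2`, so it is a unit; with a single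
infinite place, its absolute values are then `1`, and Kronecker's theorem applies. -/
theorem NumberField.pow_eq_one_of_mulHeight₁_lt_two
    (hK : ∀ v w : InfinitePlace K, v = w) {x : K} (hx : x ≠ 0) (h : mulHeight₁ x < 2) :
    ∃ n : ℕ, 0 < n ∧ x ^ n = 1 := by
  have hint : ∀ y : K, mulHeight₁ y < 2 → IsIntegral ℤ y := by
    intro y hy
    obtain ⟨n, hn0, hn, hi⟩ := exists_nat_le_mulHeight₁ y
    have : n = 1 := by
      have : (n : ℝ) < 2 := hn.trans_lt hy
      have : n < 2 := by exact_mod_cast this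
      omega
    simpa [this] using hi
  have hx1 := hint x h
  have hx2 := hint x⁻¹ (by rwa [mulHeight₁_inv])
  let u : (𝓞 K)ˣ := ⟨⟨x, hx1⟩, ⟨x⁻¹, hx2⟩, RingOfIntegers.ext (mul_inv_cancel₀ hx),
    RingOfIntegers.ext (inv_mul_cancel₀ hx)⟩
  have hu : ∀ w : InfinitePlace K, w (u : K) = 1 := by
    intro w
    have h := Units.sum_mult_mul_log u
    rw [Finset.sum_eq_single w (fun v _ hv => absurd (hK v w) hv) (by simp)] at h
    have hlog := (mul_eq_zero.mp h).resolve_left InfinitePlace.mult_coe_ne_zero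
    exact Real.eq_one_of_pos_of_log_eq_zero (Units.pos_at_place u w) hlog
  have ht := (Units.mem_torsion K).mpr hu
  obtain ⟨n, hn, hpow⟩ := isOfFinOrder_iff_pow_eq_one.mp ht
  exact ⟨n, hn, congrArg (fun y : (𝓞 K)ˣ => (y : K)) hpow⟩

theorem NumberField.pow_torsionOrder_eq_one {x : K} {n : ℕ} (hn : 0 < n) (hx : x ^ n = 1) :
    x ^ Units.torsionOrder K = 1 := by
  have hx0 : x ≠ 0 := by
    rintro rfl
    simp [hn.ne'] at hx
  have hx1 : IsIntegral ℤ x := .of_pow hn (hx ▸ isIntegral_one)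
  have hx2 : IsIntegral ℤ x⁻¹ := .of_pow hn (by rw [inv_pow, hx, inv_one]; exact isIntegral_one)
  let u : (𝓞 K)ˣ := ⟨⟨x, hx1⟩, ⟨x⁻¹, hx2⟩, RingOfIntegers.ext (mul_inv_cancel₀ hx0),
    RingOfIntegers.ext (inv_mul_cancel₀ hx0)⟩
  have hu : u ∈ Units.torsion K :=
    isOfFinOrder_iff_pow_eq_one.mpr ⟨n, hn, Units.ext (RingOfIntegers.ext hx)⟩
  have h : (⟨u, hu⟩ : Units.torsion K) ^ Units.torsionOrder K = 1 := pow_card_eq_one'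
  exact congrArg (fun y : Units.torsion K => ((y : (𝓞 K)ˣ) : K)) h

end NumberField

/-! ### The Frobenius congruence and the Amoroso-Dvornicich inequality -/

section Frobenius

variable {m : ℕ} [NeZero m] {K : Type*} [Field K] [NumberField K] [IsCyclotomicExtension {m} ℚ K]

theorem Polynomial.natCast_dvd_pow_sub_expand {p : ℕ} [Fact p.Prime] (P : ℤ[X]) :
    (p : ℤ[X]) ∣ P ^ p - expand ℤ p P := by
  have h : (p : ℤ[X]) = C (p : ℤ) := by simp
  rw [h, Polynomial.C_dvd_iff_dvd_coeff]
  intro i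
  rw [← ZMod.intCast_zmod_eq_zero_iff_dvd]
  have h2 : ((P ^ p - expand ℤ p P).map (Int.castRingHom (ZMod p))).coeff i = 0 := by
    rw [Polynomial.map_sub, Polynomial.map_pow, Polynomial.map_expand, ZMod.expand_card,
      sub_self, coeff_zero]
  rwa [coeff_map] at h2

variable (m K) in
/-- The Frobenius automorphism `σ` of `ℚ(ζ_m)` at a prime `p` not dividing `m`, with `a ^ p ≡ σ a`
modulo `p` for every integer `a`: it raises `ζ_m` to the power `p`, and `a` is an integer polynomial
in `ζ_m`. -/
theorem IsCyclotomicExtension.exists_frobenius {p : ℕ} [Fact p.Prime] (hpm : p.Coprime m) :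
    ∃ σ : K ≃ₐ[ℚ] K, ∀ y : 𝓞 K, ∃ z : 𝓞 K, (y : K) ^ p - σ (y : K) = (p : K) * (z : K) := by
  let σ : K ≃ₐ[ℚ] K := (IsCyclotomicExtension.Rat.galEquivZMod m K).symm
    (ZMod.unitOfCoprime p hpm)
  have hζ := IsCyclotomicExtension.zeta_spec m ℚ K
  set ζ := IsCyclotomicExtension.zeta m ℚ K
  have hσ : σ ζ = ζ ^ p := by
    rw [IsCyclotomicExtension.Rat.galEquivZMod_apply_of_pow_eq m K σ hζ.pow_eq_one]
    simp only [σ, MulEquiv.apply_symm_apply, ZMod.coe_unitOfCoprime, ZMod.val_natCast]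
    rw [hζ.eq_orderOf, pow_mod_orderOf]
  refine ⟨σ, fun y => ?_⟩
  have hy : (y : K) ∈ Algebra.adjoin ℤ {ζ} := by
    have := IsCyclotomicExtension.Rat.isIntegralClosure_adjoin_singleton hζ
    obtain ⟨z, hz⟩ := (IsIntegralClosure.isIntegral_iff (A := Algebra.adjoin ℤ {ζ})).mp
      y.isIntegral_coe
    have hz' : (z : K) = (y : K) := hz
    rw [← hz']
    exact z.2
  rw [Algebra.adjoin_singleton_eq_range_aeval] at hy
  obtain ⟨P, hP⟩ := hy
  obtain ⟨Q, hQ⟩ := Polynomial.natCast_dvd_pow_sub_expand (p := p) P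
  have hint : IsIntegral ℤ (aeval ζ Q) :=
    IsIntegral.of_mem_of_fg _ (hζ.isIntegral (NeZero.pos m)).fg_adjoin_singleton _
      (aeval_mem_adjoin_singleton ℤ ζ)
  refine ⟨⟨aeval ζ Q, hint⟩, ?_⟩
  have h := congrArg (aeval ζ) hQ
  have h2 : σ (aeval ζ P) = aeval (ζ ^ p) P := by
    rw [← hσ]
    exact (Polynomial.aeval_algHom_apply ((σ : K →ₐ[ℚ] K).restrictScalars ℤ) ζ P).symm
  simp only [map_sub, map_pow, expand_aeval, map_mul, map_natCast] at h
  rw [← hP]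
  exact (congrArg _ h2).trans h

end Frobenius

section Local

variable {K : Type*} [Field K] [NumberField K]

theorem NumberField.FinitePlace.apply_integer_le_one (v : FinitePlace K) (x : 𝓞 K) :
    v (x : K) ≤ 1 := by
  rw [← FinitePlace.norm_embedding_eq]
  exact FinitePlace.norm_le_one K v.maximalIdeal x

theorem NumberField.FinitePlace.apply_sub_le (v : FinitePlace K) (x y : K) :
    v (x - y) ≤ max (v x) (v y) := by
  have h := v.add_le x (-y)
  rwa [← sub_eq_add_neg, map_neg_eq_map] at h

/-- An element integral at `v` is a quotient of integers whose denominator is a unit at `v`. -/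
theorem NumberField.FinitePlace.exists_mul_eq_integer (v : FinitePlace K) {x : K} (hx : v x ≤ 1) :
    ∃ a d : 𝓞 K, v (d : K) = 1 ∧ x * (d : K) = (a : K) := by
  have hone : ∀ d : v.maximalIdeal.asIdeal.primeCompl, v ((d : 𝓞 K) : K) = 1 := fun d => by
    rw [← FinitePlace.norm_embedding_eq]
    exact (FinitePlace.norm_eq_one_iff_notMem K v.maximalIdeal _).mpr d.2
  obtain ⟨n, d, h | h⟩ := v.maximalIdeal.exists_primeCompl_mul_eq_or_mul_eq x
  · exact ⟨n, d, hone d, h⟩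
  · refine ⟨d, n, ?_, h⟩
    have h1 := congrArg v h
    rw [map_mul] at h1
    have h2 := h1.trans (hone d)
    refine le_antisymm (v.apply_integer_le_one n) ?_
    calc (1 : ℝ) = v x * v (n : K) := h2.symm
      _ ≤ v (n : K) := mul_le_of_le_one_left (apply_nonneg v _) hx

variable {p : ℕ} {σ : K ≃ₐ[ℚ] K}
  (hσ : ∀ y : 𝓞 K, ∃ z : 𝓞 K, (y : K) ^ p - σ (y : K) = (p : K) * (z : K))

include hσ in
/-- Above `p`, the congruence `a ^ p ≡ σ a` extends from the integers to the elements integral at `v`,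
and `σ` preserves integrality at `v`. -/
theorem NumberField.FinitePlace.apply_pow_sub_le_of_le_one (v : FinitePlace K) (hp : v (p : K) < 1)
    {x : K} (hx : v x ≤ 1) : v (x ^ p - σ x) ≤ v (p : K) ∧ v (σ x) ≤ 1 := by
  have hint : ∀ y : 𝓞 K, v (σ (y : K)) ≤ 1 := fun y =>
    v.apply_integer_le_one (RingOfIntegers.mapRingEquiv (σ : K ≃+* K) y)
  obtain ⟨a, d, hd, hxd⟩ := v.exists_mul_eq_integer hx
  obtain ⟨z, hz⟩ := hσ d
  obtain ⟨w, hw⟩ := hσ a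
  have hσd : v (σ (d : K)) = 1 := by
    refine le_antisymm (hint d) ?_
    by_contra! hlt
    have h1 : (d : K) ^ p = σ (d : K) + (p : K) * (z : K) := by rw [← hz]; ring
    have h2 := v.add_le (σ (d : K)) ((p : K) * (z : K))
    rw [← h1, map_pow, hd, one_pow, map_mul] at h2
    have h3 : v (p : K) * v (z : K) < 1 :=
      (mul_le_of_le_one_right (apply_nonneg v _) (v.apply_integer_le_one z)).trans_lt hp
    exact absurd h2 (not_le.mpr (max_lt hlt h3))
  have hσx : σ x * σ (d : K) = σ (a : K) := by rw [← map_mul, hxd]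
  constructor
  -- Multiply through by the unit `d ^ p * σ d` at `v` to reduce to integers.
  · have key : (x ^ p - σ x) * ((d : K) ^ p * σ (d : K)) =
        (p : K) * ((w : K) * σ (d : K) - σ (a : K) * (z : K)) := by
      have h1 : x ^ p * (d : K) ^ p = (a : K) ^ p := by rw [← mul_pow, hxd]
      linear_combination σ (d : K) * h1 - (d : K) ^ p * hσx + σ (d : K) * hw - σ (a : K) * hz
    have h1 := congrArg v key
    rw [map_mul, map_mul, map_pow, hd, hσd, one_pow, one_mul, mul_one, map_mul] at h1
    rw [h1]
    refine mul_le_of_le_one_right (apply_nonneg v _) ((v.apply_sub_le _ _).trans (max_le ?_ ?_))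
    · rw [map_mul, hσd, mul_one]; exact v.apply_integer_le_one w
    · rw [map_mul]
      exact mul_le_one₀ (hint a) (apply_nonneg v _) (v.apply_integer_le_one z)
  · have h1 := congrArg v hσx
    rw [map_mul, hσd, mul_one] at h1
    rw [h1]; exact hint a

include hσ in
/-- The quantity `x ^ p - σ x` is divisible by `p` up to denominators. Where `x` is not integral, the
congruence for `x⁻¹` is multiplied by `x ^ p * σ x`. -/
theorem NumberField.FinitePlace.apply_pow_sub_le (v : FinitePlace K) (x : K) :
    v (x ^ p - σ x) ≤ v (p : K) * (max (v x) 1 ^ p * max (v (σ x)) 1) := by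
  have hp1 : v (p : K) ≤ 1 := by simpa using v.apply_integer_le_one (p : 𝓞 K)
  rcases hp1.lt_or_eq with hp | hp
  · rcases le_or_gt (v x) 1 with hx | hx
    · obtain ⟨h1, h2⟩ := v.apply_pow_sub_le_of_le_one hσ hp hx
      simpa [max_eq_right hx, max_eq_right h2] using h1
    · have hx0 : x ≠ 0 := by rintro rfl; simp at hx; linarith
      have hσ0 : σ x ≠ 0 := by simpa using hx0
      have hxi : v x⁻¹ ≤ 1 := by rw [map_inv₀]; exact inv_le_one_of_one_le₀ hx.le
      obtain ⟨h1, h2⟩ := v.apply_pow_sub_le_of_le_one hσ hp hxi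
      have key : x ^ p - σ x = -((x⁻¹ ^ p - σ x⁻¹) * (x ^ p * σ x)) := by
        rw [map_inv₀, inv_pow]; field_simp; ring
      rw [key, map_neg_eq_map, map_mul, map_mul, map_pow]
      gcongr
      · exact le_max_left _ _
      · exact le_max_left _ _
  · rw [hp, one_mul]
    refine (v.apply_sub_le _ _).trans (max_le ?_ ?_)
    · rw [map_pow]
      calc v x ^ p ≤ max (v x) 1 ^ p * 1 := by
            rw [mul_one]; gcongr; exact le_max_left _ _
        _ ≤ _ := by gcongr; exact le_max_right _ _
    · calc v (σ x) ≤ 1 * max (v (σ x)) 1 := by rw [one_mul]; exact le_max_left _ _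
        _ ≤ _ := by gcongr; exact one_le_pow₀ (le_max_right _ _)

theorem NumberField.InfinitePlace.apply_pow_sub_le (v : InfinitePlace K) (x y : K) (p : ℕ) :
    v (x ^ p - y) ≤ 2 * (max (v x) 1 ^ p * max (v y) 1) := by
  have h1 : v (x ^ p) ≤ max (v x) 1 ^ p * max (v y) 1 := by
    rw [map_pow]
    calc v x ^ p ≤ max (v x) 1 ^ p * 1 := by
          rw [mul_one]; gcongr; exact le_max_left _ _
      _ ≤ _ := by gcongr; exact le_max_right _ _
  have h2 : v y ≤ max (v x) 1 ^ p * max (v y) 1 := by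
    calc v y ≤ 1 * max (v y) 1 := by rw [one_mul]; exact le_max_left _ _
      _ ≤ _ := by gcongr; exact one_le_pow₀ (le_max_right _ _)
  have h3 : v (x ^ p - y) ≤ v (x ^ p) + v y := by
    simp only [← InfinitePlace.norm_embedding_eq, map_sub]
    exact norm_sub_le _ _
  linarith

include hσ in
/-- The product formula for the nonzero element `x ^ p - σ x`, whose absolute values are small at the
finite places above `p`. -/
theorem NumberField.prime_pow_le_mulHeight₁ (hp : p ≠ 0) {x : K} (hx : x ^ p ≠ σ x) :
    (p : ℝ) ^ Module.finrank ℚ K ≤ 2 ^ Module.finrank ℚ K * mulHeight₁ x ^ (p + 1) := by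
  set d := Module.finrank ℚ K
  have hγ : x ^ p - σ x ≠ 0 := sub_ne_zero.mpr hx
  have hp' : (p : K) ≠ 0 := by exact_mod_cast hp
  have hpf := prod_abs_eq_one hγ
  have hfin : ∀ y : K, (fun v : FinitePlace K => max (v y) 1).HasFiniteMulSupport := by
    intro y
    rcases eq_or_ne y 0 with rfl | hy
    · simp [Function.HasFiniteMulSupport]
    · refine (FinitePlace.hasFiniteMulSupport hy).subset fun v hv => ?_
      rw [Function.mem_mulSupport] at hv ⊢
      contrapose! hv
      simp [hv]
  have harch : ∏ w : InfinitePlace K, w (x ^ p - σ x) ^ w.mult ≤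
      2 ^ d * ((∏ w : InfinitePlace K, max (w x) 1 ^ w.mult) ^ p *
        ∏ w : InfinitePlace K, max (w (σ x)) 1 ^ w.mult) := by
    calc _ ≤ ∏ w : InfinitePlace K, (2 * (max (w x) 1 ^ p * max (w (σ x)) 1)) ^ w.mult := by
          gcongr with w
          exact w.apply_pow_sub_le _ _ _
      _ = _ := by
          simp only [mul_pow, Finset.prod_mul_distrib, ← Finset.prod_pow]
          rw [Finset.prod_pow_eq_pow_sum, InfinitePlace.sum_mult_eq]
          simp only [← pow_mul, mul_comm p]
          rfl
  have hnon : ∏ᶠ v : FinitePlace K, v (x ^ p - σ x) ≤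
      (∏ᶠ v : FinitePlace K, v (p : K)) * ((∏ᶠ v : FinitePlace K, max (v x) 1) ^ p *
        ∏ᶠ v : FinitePlace K, max (v (σ x)) 1) := by
    rw [finprod_pow (hfin x), ← finprod_mul_distrib (by have := hfin x; fun_prop) (hfin _),
      ← finprod_mul_distrib (FinitePlace.hasFiniteMulSupport hp')
        (by have := hfin x; have := hfin (σ x); fun_prop)]
    refine finprod_le_finprod (FinitePlace.hasFiniteMulSupport hγ) (fun v => apply_nonneg v _)
      ?_ fun v => v.apply_pow_sub_le hσ x
    have := FinitePlace.hasFiniteMulSupport hp'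
    have := hfin x
    have := hfin (σ x)
    fun_prop
  have hp2 := NumberField.prod_finitePlace_natCast (K := K) hp
  have hH := NumberField.mulHeight₁_algEquiv σ x
  rw [pow_succ]
  nth_rewrite 2 [← hH]
  rw [NumberField.mulHeight₁_eq x, NumberField.mulHeight₁_eq (σ x)]
  set A := ∏ w : InfinitePlace K, max (w x) 1 ^ w.mult
  set A' := ∏ w : InfinitePlace K, max (w (σ x)) 1 ^ w.mult
  set B := ∏ᶠ v : FinitePlace K, max (v x) 1
  set B' := ∏ᶠ v : FinitePlace K, max (v (σ x)) 1
  set P := ∏ᶠ v : FinitePlace K, v (p : K)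
  have hF0 : 0 ≤ ∏ᶠ v : FinitePlace K, v (x ^ p - σ x) := finprod_nonneg fun v => apply_nonneg v _
  have hA : 0 ≤ 2 ^ d * (A ^ p * A') := by positivity
  have h := mul_le_mul harch hnon hF0 hA
  rw [hpf] at h
  have hpd : (0 : ℝ) ≤ (p : ℝ) ^ d := by positivity
  calc (p : ℝ) ^ d = (p : ℝ) ^ d * 1 := (mul_one _).symm
    _ ≤ (p : ℝ) ^ d * (2 ^ d * (A ^ p * A') * (P * (B ^ p * B'))) := by gcongr
    _ = ((p : ℝ) ^ d * P) * (2 ^ d * ((A * B) ^ p * (A' * B'))) := by ring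
    _ = _ := by rw [hp2, one_mul]

/-- If `σ` acts on `x` as raising to the power `p`, then so does `σ ^ k` with `p ^ k`; take for `k` the
order of `σ`. -/
theorem AlgEquiv.pow_eq_one_of_pow_eq (hp : 2 ≤ p) {x : K} (hx0 : x ≠ 0) (hx : x ^ p = σ x) :
    ∃ n : ℕ, 0 < n ∧ x ^ n = 1 := by
  have hiter : ∀ k : ℕ, (σ ^ k) x = x ^ p ^ k := by
    intro k
    induction k with
    | zero => simp
    | succ k ih => rw [pow_succ', AlgEquiv.mul_apply, ih, map_pow, ← hx, ← pow_mul, ← pow_succ']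
  obtain ⟨k, hk, hk1⟩ := isOfFinOrder_iff_pow_eq_one.mp (isOfFinOrder_of_finite σ)
  have h := hiter k
  rw [hk1, AlgEquiv.one_apply] at h
  have hpk : 1 < p ^ k := Nat.one_lt_pow hk.ne' hp
  refine ⟨p ^ k - 1, by omega, ?_⟩
  apply mul_right_cancel₀ hx0
  rw [← pow_succ, Nat.sub_add_cancel hpk.le, ← h, one_mul]

end Local

/-! ### Height bounds in cyclotomic fields -/

theorem Rat.exists_primitive_integer_multiple {ι : Type*} [Fintype ι] {x : ι → ℚ} (hx : x ≠ 0) :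
    ∃ (t : ℚ) (a : ι → ℤ), t ≠ 0 ∧ Finset.univ.gcd a = 1 ∧ ∀ i, x i = t * (a i : ℚ) := by
  obtain ⟨i₀, hi₀⟩ := Function.ne_iff.mp hx
  obtain ⟨b, hb⟩ := IsLocalization.exist_integer_multiples_of_finite (nonZeroDivisors ℤ) x
  choose y hy using hb
  have hb0 : ((b : ℤ) : ℚ) ≠ 0 := by exact_mod_cast nonZeroDivisors.coe_ne_zero b
  have hy' : ∀ i, (y i : ℚ) = ((b : ℤ) : ℚ) * x i := fun i => by
    have h := hy i
    rw [zsmul_eq_mul] at h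
    exact h
  have hyi : y i₀ ≠ 0 := by
    intro h
    have h2 := hy' i₀
    rw [h, Int.cast_zero] at h2
    exact (mul_ne_zero hb0 hi₀) h2.symm
  obtain ⟨a, ha, hgcd⟩ := Finset.extract_gcd y ⟨i₀, Finset.mem_univ i₀⟩
  have hg0 : Finset.univ.gcd y ≠ 0 := fun h => hyi (Finset.gcd_eq_zero_iff.mp h i₀ (by simp))
  refine ⟨(Finset.univ.gcd y : ℤ) / ((b : ℤ) : ℚ), a, ?_, hgcd, fun i => ?_⟩
  · exact div_ne_zero (by exact_mod_cast hg0) hb0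
  · have h := hy' i
    rw [ha i (Finset.mem_univ i), Int.cast_mul] at h
    field_simp
    linarith

section HeightBounds

variable {K : Type*} [Field K] [NumberField K]

theorem NumberField.InfinitePlace.apply_sum_intCast_mul_pow_le (w : InfinitePlace K) {ξ : K}
    (hξ : w ξ = 1) {M : ℤ} {d D : ℕ} (hd : d ≤ D) (a : Fin (d + 1) → ℤ) (ha : ∀ i, |a i| ≤ M) :
    w (∑ i, (a i : K) * ξ ^ (i : ℕ)) ≤ (D + 1) * M := by
  have hM : (0 : ℝ) ≤ M := by exact_mod_cast (abs_nonneg _).trans (ha 0)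
  rw [← InfinitePlace.norm_embedding_eq, map_sum]
  calc ‖∑ i, w.embedding ((a i : K) * ξ ^ (i : ℕ))‖
      ≤ ∑ i, ‖w.embedding ((a i : K) * ξ ^ (i : ℕ))‖ := norm_sum_le _ _
    _ ≤ ∑ i : Fin (d + 1), (M : ℝ) := by
        refine Finset.sum_le_sum fun i _ => ?_
        rw [map_mul, map_pow, norm_mul, norm_pow, InfinitePlace.norm_embedding_eq w ξ, hξ, one_pow,
          mul_one, map_intCast, Complex.norm_intCast]
        exact_mod_cast ha i
    _ = (d + 1) * M := by simp
    _ ≤ (D + 1) * M := by gcongr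

theorem Polynomial.aeval_eq_sum_of_coeff_eq {g : ℚ[X]} {t : ℚ} {a : Fin (g.natDegree + 1) → ℤ}
    (h : ∀ i : Fin (g.natDegree + 1), g.coeff i = t * (a i : ℚ)) (ξ : K) :
    aeval ξ g = (t : K) * ∑ i, (a i : K) * ξ ^ (i : ℕ) := by
  rw [aeval_eq_sum_range, ← Fin.sum_univ_eq_sum_range (fun i => g.coeff i • ξ ^ i), Finset.mul_sum]
  refine Finset.sum_congr rfl fun i _ => ?_
  rw [h i, Algebra.smul_def, map_mul, map_intCast, eq_ratCast, mul_assoc]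

/-- The height of a quotient of values of two polynomials at a root of unity. Up to a common rational
factor the values are integers of `K`, and their absolute values are at most `D + 1` times the
largest coefficient. -/
theorem logHeight₁_aeval_div_aeval_le {g₁ g₂ : ℚ[X]} {D : ℕ} (h₁ : g₁.natDegree ≤ D)
    (h₂ : g₂.natDegree ≤ D) {ξ : K} {m : ℕ} (hm : m ≠ 0) (hξ : ξ ^ m = 1)
    (hne : aeval ξ g₂ ≠ 0) :
    logHeight₁ (aeval ξ g₁ / aeval ξ g₂) ≤
      Module.finrank ℚ K * (pairHeight g₁ g₂ + Real.log (D + 1)) := by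
  have hv : coeffVector g₁ g₂ ≠ 0 := by
    intro h
    have hg : g₂ = 0 := by
      rw [← leadingCoeff_eq_zero]
      have := congrFun h (Sum.inr (Fin.last _))
      simpa [coeffVector] using this
    simp [hg] at hne
  obtain ⟨t, a, ht, hgcd, hta⟩ := Rat.exists_primitive_integer_multiple hv
  rw [pairHeight_eq_log_max g₁ g₂ t ht a hgcd hta]
  set M : ℤ := ⨆ i, |a i| with hMdef
  have haM : ∀ i, |a i| ≤ M := fun i => Finite.le_ciSup (fun i => |a i|) i
  have hM : 1 ≤ M := by
    by_contra! hlt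
    have h0 : ∀ i, a i = 0 := fun i => abs_eq_zero.mp
      (le_antisymm ((haM i).trans (by omega)) (abs_nonneg _))
    rw [Finset.gcd_eq_zero_iff.mpr (fun i _ => h0 i)] at hgcd
    exact zero_ne_one hgcd
  have hξint : IsIntegral ℤ ξ := .of_pow (Nat.pos_of_ne_zero hm) (hξ ▸ isIntegral_one)
  let ξ' : 𝓞 K := ⟨ξ, hξint⟩
  let y₁ : 𝓞 K := ∑ i, (a (Sum.inl i) : 𝓞 K) * ξ' ^ (i : ℕ)
  let y₂ : 𝓞 K := ∑ i, (a (Sum.inr i) : 𝓞 K) * ξ' ^ (i : ℕ)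
  have hy₁ : (y₁ : K) = ∑ i, (a (Sum.inl i) : K) * ξ ^ (i : ℕ) := by
    simp only [y₁, map_sum, map_mul, map_pow, map_intCast]; rfl
  have hy₂ : (y₂ : K) = ∑ i, (a (Sum.inr i) : K) * ξ ^ (i : ℕ) := by
    simp only [y₂, map_sum, map_mul, map_pow, map_intCast]; rfl
  have e₁ : aeval ξ g₁ = (t : K) * (y₁ : K) := by
    rw [hy₁]; exact aeval_eq_sum_of_coeff_eq (fun i => hta (Sum.inl i)) ξ
  have e₂ : aeval ξ g₂ = (t : K) * (y₂ : K) := by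
    rw [hy₂]; exact aeval_eq_sum_of_coeff_eq (fun i => hta (Sum.inr i)) ξ
  have ht' : (t : K) ≠ 0 := by exact_mod_cast ht
  have hy0 : ![y₁, y₂] ≠ 0 := by
    intro h
    have h2 : y₂ = 0 := congrFun h 1
    rw [e₂, h2] at hne
    simp at hne
  have hxi : ∀ w : InfinitePlace K, w ξ = 1 := fun w => by
    have := congrArg w hξ
    rw [map_pow, map_one] at this
    exact (pow_eq_one_iff_of_nonneg (apply_nonneg w _) hm).mp this
  have hB : (1 : ℝ) ≤ (D + 1) * M := by
    have h1 : (1 : ℝ) ≤ M := by exact_mod_cast hM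
    have h2 : (1 : ℝ) ≤ D + 1 := by simp
    exact one_le_mul_of_one_le_of_one_le h2 h1
  have hH : mulHeight (fun i => (![y₁, y₂] i : K)) ≤ ((D + 1) * M) ^ Module.finrank ℚ K := by
    have h1 := NumberField.mulHeight_mul_absNorm hy0
    have hN : (1 : ℝ) ≤ (Ideal.span (Set.range ![y₁, y₂])).absNorm := by
      rw [Nat.one_le_cast, Nat.one_le_iff_ne_zero, Ne, Ideal.absNorm_eq_zero_iff]
      intro h
      refine hy0 (funext fun i => Ideal.span_eq_bot.mp h _ ⟨i, rfl⟩)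
    calc mulHeight (fun i => (![y₁, y₂] i : K))
        ≤ mulHeight (fun i => (![y₁, y₂] i : K)) * (Ideal.span (Set.range ![y₁, y₂])).absNorm :=
          le_mul_of_one_le_right (mulHeight_pos _).le hN
      _ = ∏ v : InfinitePlace K, (⨆ i, v (![y₁, y₂] i)) ^ v.mult := h1
      _ ≤ ∏ v : InfinitePlace K, (((D : ℝ) + 1) * M) ^ v.mult := by
          gcongr with v
          · exact fun i _ => pow_nonneg (Real.iSup_nonneg fun _ => apply_nonneg i _) _
          · exact Real.iSup_nonneg fun _ => apply_nonneg v _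
          · refine ciSup_le fun i => ?_
            fin_cases i
            · change v (y₁ : K) ≤ _
              rw [hy₁]
              exact v.apply_sum_intCast_mul_pow_le (hxi v) h₁ _ fun i => haM _
            · change v (y₂ : K) ≤ _
              rw [hy₂]
              exact v.apply_sum_intCast_mul_pow_le (hxi v) h₂ _ fun i => haM _
      _ = ((D + 1) * M) ^ Module.finrank ℚ K := by
          rw [Finset.prod_pow_eq_pow_sum, InfinitePlace.sum_mult_eq]
  have hq : aeval ξ g₁ / aeval ξ g₂ = (y₁ : K) / (y₂ : K) := by
    rw [e₁, e₂, mul_div_mul_left _ _ ht']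
  have hvec : (fun i => (![y₁, y₂] i : K)) = ![(y₁ : K), (y₂ : K)] := by
    ext i; fin_cases i <;> rfl
  rw [hvec] at hH
  rw [hq, logHeight₁_eq_log_mulHeight₁, mulHeight₁_div_eq_mulHeight]
  calc Real.log (mulHeight ![(y₁ : K), (y₂ : K)])
      ≤ Real.log (((D + 1) * M) ^ Module.finrank ℚ K) := Real.log_le_log (mulHeight_pos _) hH
    _ = _ := by
      have h1 : (M : ℝ) ≠ 0 := by
        have : M ≠ 0 := by omega
        exact_mod_cast this
      have h2 : (D : ℝ) + 1 ≠ 0 := by positivity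
      rw [Real.log_pow, Real.log_mul h2 h1, add_comm]

end HeightBounds

section LowerBound

variable {m : ℕ} [NeZero m] {K : Type*} [Field K] [NumberField K] [IsCyclotomicExtension {m} ℚ K]

variable (m) in
/-- The lower bound of Amoroso and Dvornicich for the height in `ℚ(ζ_m)` (not normalized by the
degree), in the case of a prime `p` not dividing `m`. -/
theorem IsCyclotomicExtension.log_le_logHeight₁ {p : ℕ} (hp : p.Prime) (hpm : p.Coprime m) {x : K}
    (hx0 : x ≠ 0) (hx : ∀ n : ℕ, 0 < n → x ^ n ≠ 1) :
    Module.finrank ℚ K * Real.log (p / 2) ≤ (p + 1) * logHeight₁ x := by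
  have : Fact p.Prime := ⟨hp⟩
  obtain ⟨σ, hσ⟩ := IsCyclotomicExtension.exists_frobenius m K hpm
  have hne : x ^ p ≠ σ x := by
    intro h
    obtain ⟨n, hn, h1⟩ := AlgEquiv.pow_eq_one_of_pow_eq hp.two_le hx0 h
    exact hx n hn h1
  have h := NumberField.prime_pow_le_mulHeight₁ hσ hp.ne_zero hne
  have hp0 : (0 : ℝ) < p := by exact_mod_cast hp.pos
  have hH := mulHeight₁_pos x
  have h2 := Real.log_le_log (by positivity) h
  rw [Real.log_pow, Real.log_mul (by positivity) (by positivity), Real.log_pow, Real.log_pow] at h2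
  rw [Real.log_div hp0.ne' two_ne_zero, logHeight₁_eq_log_mulHeight₁]
  push_cast at h2
  linarith

/-- An odd prime factor of `m - 1` (for even `m`) or of `m - 2` (for odd `m`) is coprime to `m`. -/
theorem Nat.exists_prime_coprime_lt {m : ℕ} (hm : 5 ≤ m) :
    ∃ p : ℕ, p.Prime ∧ p.Coprime m ∧ 3 ≤ p ∧ p + 1 ≤ m := by
  obtain ⟨k, hk3, hkm, hodd, hcop⟩ : ∃ k : ℕ, 3 ≤ k ∧ k + 1 ≤ m ∧ Odd k ∧ k.Coprime m := by
    rcases Nat.even_or_odd m with he | ho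
    · refine ⟨m - 1, by omega, by omega, ?_, ?_⟩
      · exact Nat.Even.sub_odd (by omega) he odd_one
      · have h := (Nat.coprime_self_add_right (m := m - 1) (n := 1)).mpr (Nat.coprime_one_right _)
        rwa [Nat.sub_add_cancel (by omega)] at h
    · have ho2 : Odd (m - 2) := Nat.Odd.sub_even (by omega) ho even_two
      refine ⟨m - 2, by omega, by omega, ho2, ?_⟩
      have h := (Nat.coprime_self_add_right (m := m - 2) (n := 2)).mpr ho2.coprime_two_right
      rwa [Nat.sub_add_cancel (by omega)] at h
  have hp := Nat.minFac_prime (n := k) (by omega)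
  have hle := Nat.minFac_le (n := k) (by omega)
  refine ⟨k.minFac, hp, hcop.coprime_dvd_left (Nat.minFac_dvd k), ?_, by omega⟩
  have hne : k.minFac ≠ 2 := by
    intro h
    have h2 : 2 ∣ k := h ▸ Nat.minFac_dvd k
    exact (Nat.not_even_iff_odd.mpr hodd) (even_iff_two_dvd.mpr h2)
  have := hp.two_le
  omega

theorem IsCyclotomicExtension.log_two_le_logHeight₁_of_totient_eq_two (hm : 3 ≤ m)
    (hφ : m.totient = 2) {x : K} (hx0 : x ≠ 0) (hx : ∀ n : ℕ, 0 < n → x ^ n ≠ 1) :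
    Real.log 2 ≤ logHeight₁ x := by
  rw [logHeight₁_eq_log_mulHeight₁]
  refine Real.log_le_log two_pos ?_
  by_contra! h
  have hcard : Fintype.card (InfinitePlace K) = 1 := by
    rw [InfinitePlace.card_eq_nrRealPlaces_add_nrComplexPlaces,
      IsCyclotomicExtension.Rat.nrRealPlaces_eq_zero (n := m) K (by omega),
      IsCyclotomicExtension.Rat.nrComplexPlaces_eq_totient_div_two m K, hφ]
  obtain ⟨n, hn, h1⟩ := NumberField.pow_eq_one_of_mulHeight₁_lt_two
    (fun v w => Fintype.card_le_one_iff.mp hcard.le v w) hx0 h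
  exact hx n hn h1

/-- The lower bound for heights in the form used below. The factor `1 + log 2 / 3` absorbs the passage
from `X + log (D + 1)` to `X + log D`, as `X ≥ 3`. -/
theorem IsCyclotomicExtension.finrank_le_mul_logHeight₁ (hm : 3 ≤ m) {x : K}
    (hx0 : x ≠ 0) (hx : ∀ n : ℕ, 0 < n → x ^ n ≠ 1) :
    (1 + Real.log 2 / 3) * Module.finrank ℚ K ≤ m * Real.log m ^ 3 * logHeight₁ x := by
  have hfin := IsCyclotomicExtension.Rat.finrank m K
  have l2 := Real.log_two_gt_d9
  have l2' := Real.log_two_lt_d9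
  have l3 := Real.log_three_gt_d9
  have hm' : (3 : ℝ) ≤ m := by exact_mod_cast hm
  have hlog3 : Real.log 3 ≤ Real.log m := Real.log_le_log (by norm_num) hm'
  rcases le_or_gt 5 m with h5 | h5
  · obtain ⟨p, hp, hcop, hp3, hpm⟩ := Nat.exists_prime_coprime_lt h5
    have h := IsCyclotomicExtension.log_le_logHeight₁ m hp hcop hx0 hx
    have hh := zero_le_logHeight₁ x
    have hp3' : (3 : ℝ) ≤ p := by exact_mod_cast hp3
    have hpm' : (p : ℝ) + 1 ≤ m := by exact_mod_cast hpm
    have hlp : 0.4 ≤ Real.log (p / 2) := by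
      rw [Real.log_div (by positivity) two_ne_zero]
      have := Real.log_le_log (by norm_num) hp3'
      linarith
    have h5' : (5 : ℝ) ≤ m := by exact_mod_cast h5
    -- `2 ^ 9 < 5 ^ 4` and `log 2 > 0.69`.
    have hlog5 : 1.5 ≤ Real.log m := by
      have h1 : Real.log 5 ≤ Real.log m := Real.log_le_log (by norm_num) h5'
      have h2 : Real.log (2 ^ 9) ≤ Real.log (5 ^ 4) := Real.log_le_log (by norm_num) (by norm_num)
      rw [Real.log_pow, Real.log_pow] at h2
      push_cast at h2
      linarith
    have hcube : (1.5 : ℝ) ^ 3 ≤ Real.log m ^ 3 := by gcongr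
    have hd : (0 : ℝ) ≤ Module.finrank ℚ K := by positivity
    have e1 : (Module.finrank ℚ K : ℝ) * 0.4 ≤ m * logHeight₁ x := by
      calc (Module.finrank ℚ K : ℝ) * 0.4 ≤ Module.finrank ℚ K * Real.log (p / 2) := by gcongr
        _ ≤ (p + 1) * logHeight₁ x := h
        _ ≤ m * logHeight₁ x := by gcongr
    calc (1 + Real.log 2 / 3) * Module.finrank ℚ K ≤ 1.5 ^ 3 * (Module.finrank ℚ K * 0.4) := by
          nlinarith
      _ ≤ Real.log m ^ 3 * (m * logHeight₁ x) := by gcongr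
      _ = _ := by ring
  · have hφ : m.totient = 2 := by interval_cases m <;> rfl
    have h := IsCyclotomicExtension.log_two_le_logHeight₁_of_totient_eq_two hm hφ hx0 hx
    rw [hfin, hφ]
    have hcube : (1.09 : ℝ) ^ 3 ≤ Real.log m ^ 3 := by
      gcongr
      linarith
    calc (1 + Real.log 2 / 3) * (2 : ℕ) ≤ 3 * 1.09 ^ 3 * Real.log 2 := by
          push_cast
          norm_num
          linarith
      _ ≤ _ := by gcongr

theorem IsCyclotomicExtension.pow_eq_one_of_pow_eq_one {x : K} {n : ℕ} (hn : 0 < n)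
    (hx : x ^ n = 1) : x ^ (if Even m then m else 2 * m) = 1 := by
  rw [← IsCyclotomicExtension.Rat.torsionOrder_eq (n := m) (K := K)]
  exact NumberField.pow_torsionOrder_eq_one hn hx

end LowerBound

/-! ### Identically vanishing power sums -/

section PowerSum

variable {c₁ c₂ f₁ f₂ : ℚ[X]}

/-- If `u_k` and `u_{k+l}` are identically zero, then `f₁ ^ l = f₂ ^ l`, so `u` is identically zero on
the whole progression. -/
theorem powerSum_add_mul_eq_zero (hc₁ : c₁ ≠ 0) (hf₁ : f₁ ≠ 0) {k l : ℕ}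
    (hk : powerSum c₁ c₂ f₁ f₂ k = 0) (hkl : powerSum c₁ c₂ f₁ f₂ (k + l) = 0) (j : ℕ) :
    powerSum c₁ c₂ f₁ f₂ (k + l * j) = 0 := by
  simp only [powerSum] at *
  have hl : f₁ ^ l = f₂ ^ l := by
    apply mul_left_cancel₀ (mul_ne_zero hc₁ (pow_ne_zero k hf₁))
    rw [pow_add, pow_add] at hkl
    linear_combination hkl - f₂ ^ l * hk
  rw [pow_add, pow_add, pow_mul, pow_mul, ← hl]
  linear_combination (f₁ ^ l) ^ j * hk

theorem powerSum_one_or_two_ne_zero (hc₁ : c₁ ≠ 0) (hf₁ : f₁ ≠ 0) {n : ℕ} (hn : 1 ≤ n)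
    (h : powerSum c₁ c₂ f₁ f₂ n ≠ 0) :
    powerSum c₁ c₂ f₁ f₂ 1 ≠ 0 ∨ powerSum c₁ c₂ f₁ f₂ 2 ≠ 0 := by
  rw [← not_and_or]
  rintro ⟨h1, h2⟩
  obtain ⟨j, rfl⟩ := Nat.exists_eq_add_of_le hn
  have h3 := powerSum_add_mul_eq_zero (k := 1) (l := 1) hc₁ hf₁ h1 h2 j
  rw [one_mul] at h3
  exact h h3

theorem aeval_powerSum {A : Type*} [CommRing A] [Algebra ℚ A] (ξ : A) (n : ℕ) :
    aeval ξ (powerSum c₁ c₂ f₁ f₂ n) =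
      aeval ξ c₁ * aeval ξ f₁ ^ n + aeval ξ c₂ * aeval ξ f₂ ^ n := by
  simp [powerSum]

theorem exists_le_two_mem_vanishingSet (hc₁ : c₁ ≠ 0) (hf₁ : f₁ ≠ 0) {Z : Set ℂ} {n : ℕ}
    (hn : 1 ≤ n) (h : powerSum c₁ c₂ f₁ f₂ n ≠ 0) {ζ : ℂ} (hζ : ζ ∈ Z)
    (hall : ∀ k, 1 ≤ k → aeval ζ (powerSum c₁ c₂ f₁ f₂ k) = 0) :
    ∃ k ∈ vanishingSet c₁ c₂ f₁ f₂ Z, k ≤ 2 := by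
  rcases powerSum_one_or_two_ne_zero hc₁ hf₁ hn h with h1 | h2
  · exact ⟨1, ⟨le_rfl, h1, ζ, hζ, hall 1 le_rfl⟩, by omega⟩
  · exact ⟨2, ⟨by omega, h2, ζ, hζ, hall 2 (by omega)⟩, by omega⟩

theorem aeval_powerSum_eq_zero_of_mul_eq_zero {A : Type*} [Field A] [Algebra ℚ A] {ξ : A} {n : ℕ}
    (h : aeval ξ (powerSum c₁ c₂ f₁ f₂ n) = 0)
    (h0 : (aeval ξ c₁ = 0 ∨ aeval ξ f₁ = 0) ∨ (aeval ξ c₂ = 0 ∨ aeval ξ f₂ = 0))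
    {k : ℕ} (hn : 1 ≤ n) (hk : 1 ≤ k) : aeval ξ (powerSum c₁ c₂ f₁ f₂ k) = 0 := by
  have key : ∀ a b : A, ∀ j : ℕ, 1 ≤ j → (a * b ^ j = 0 ↔ a = 0 ∨ b = 0) := fun a b j hj => by
    rw [mul_eq_zero, pow_eq_zero_iff (by omega)]
  rw [aeval_powerSum] at h ⊢
  have h12 : aeval ξ c₁ * aeval ξ f₁ ^ n = 0 ∧ aeval ξ c₂ * aeval ξ f₂ ^ n = 0 := by
    rcases h0 with h0 | h0
    · have h1 := (key _ _ n hn).mpr h0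
      exact ⟨h1, by rwa [h1, zero_add] at h⟩
    · have h1 := (key _ _ n hn).mpr h0
      exact ⟨by rwa [h1, add_zero] at h, h1⟩
  rw [key _ _ n hn, key _ _ n hn] at h12
  rw [(key _ _ k hk).mpr h12.1, (key _ _ k hk).mpr h12.2, add_zero]

/-- Write `f₁ = g a` and `f₂ = g b` with `a, b` coprime; then `a ^ k ∣ c₂` and `b ^ k ∣ c₁`, and since
`k` exceeds the degrees of `c₁` and `c₂`, both `a` and `b` are constant. -/
theorem exists_eq_C_mul_of_powerSum_eq_zero (hc₁ : c₁ ≠ 0) (hc₂ : c₂ ≠ 0) (hf₁ : f₁ ≠ 0)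
    (hf₂ : f₂ ≠ 0) {k : ℕ} (hk₁ : c₁.natDegree < k) (hk₂ : c₂.natDegree < k)
    (h : powerSum c₁ c₂ f₁ f₂ k = 0) : ∃ r : ℚ, r ≠ 0 ∧ f₁ = C r * f₂ := by
  obtain ⟨g, a, b, hcop, rfl, rfl⟩ : ∃ g a b : ℚ[X], IsCoprime a b ∧ f₁ = g * a ∧ f₂ = g * b := by
    let _ := UniqueFactorizationMonoid.toGCDMonoid ℚ[X]
    obtain ⟨a, b, ha, hb, hu⟩ := extract_gcd f₁ f₂
    exact ⟨gcd f₁ f₂, a, b, (gcd_isUnit_iff a b).mp hu, ha, hb⟩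
  have hg := left_ne_zero_of_mul hf₁
  have ha := right_ne_zero_of_mul hf₁
  have hb := right_ne_zero_of_mul hf₂
  have hab : c₁ * a ^ k = -c₂ * b ^ k := by
    apply mul_left_cancel₀ (pow_ne_zero k hg)
    simp only [powerSum, mul_pow] at h
    linear_combination h
  have hcop' : IsCoprime (a ^ k) (b ^ k) := hcop.pow
  have hdeg : ∀ {u c : ℚ[X]}, c ≠ 0 → c.natDegree < k → u ^ k ∣ c → u.natDegree = 0 := by
    intro u c hc hck hdvd
    have h1 := natDegree_le_of_dvd hdvd hc
    rw [natDegree_pow] at h1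
    by_contra hne
    have : k * 1 ≤ k * u.natDegree := Nat.mul_le_mul_left k (by omega)
    omega
  have hda : a.natDegree = 0 := hdeg (neg_ne_zero.mpr hc₂) (by simpa using hk₂)
    (hcop'.dvd_of_dvd_mul_right (Dvd.intro_left _ hab))
  have hdb : b.natDegree = 0 := hdeg hc₁ hk₁
    (hcop'.symm.dvd_of_dvd_mul_right (Dvd.intro_left _ hab.symm))
  rw [natDegree_eq_zero] at hda hdb
  obtain ⟨r, rfl⟩ := hda
  obtain ⟨s, rfl⟩ := hdb
  rw [C_ne_zero] at ha hb
  refine ⟨r / s, div_ne_zero ha hb, ?_⟩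
  rw [mul_left_comm, ← C_mul, div_mul_cancel₀ _ hb]

/-- If `u_k` is identically zero for some `k` exceeding the degrees of `c₁` and `c₂`, then every `u_n`
is a constant multiple of `c₁ f₂ ^ n`, so its zeros are zeros of all the `u_j`. -/
theorem exists_le_two_mem_vanishingSet_of_natDegree_lt (hc₁ : c₁ ≠ 0) (hc₂ : c₂ ≠ 0) (hf₁ : f₁ ≠ 0)
    (hf₂ : f₂ ≠ 0) {Z : Set ℂ} {n k : ℕ} (hk₁ : c₁.natDegree < k) (hk₂ : c₂.natDegree < k)
    (hk : powerSum c₁ c₂ f₁ f₂ k = 0) (hn : n ∈ vanishingSet c₁ c₂ f₁ f₂ Z) :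
    ∃ j ∈ vanishingSet c₁ c₂ f₁ f₂ Z, j ≤ 2 := by
  obtain ⟨hn1, hn0, ζ, hζ, hz⟩ := hn
  obtain ⟨r, hr, rfl⟩ := exists_eq_C_mul_of_powerSum_eq_zero hc₁ hc₂ hf₁ hf₂ hk₁ hk₂ hk
  obtain rfl : c₂ = -(C r ^ k * c₁) := by
    apply mul_left_cancel₀ (pow_ne_zero k hf₂)
    simp only [powerSum, mul_pow] at hk
    linear_combination hk
  refine exists_le_two_mem_vanishingSet hc₁ hf₁ hn1 hn0 hζ fun j hj =>
    aeval_powerSum_eq_zero_of_mul_eq_zero hz ?_ hn1 hj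
  have hu : powerSum c₁ (-(C r ^ k * c₁)) (C r * f₂) f₂ n = C (r ^ n - r ^ k) * (c₁ * f₂ ^ n) := by
    simp only [powerSum, C_sub, C_pow]
    ring
  have hrn : r ^ n - r ^ k ≠ 0 := by
    intro h0
    rw [hu, h0, C_0, zero_mul] at hn0
    exact hn0 rfl
  rw [hu, map_mul, aeval_C, mul_eq_zero, map_mul, map_pow, mul_eq_zero,
    pow_eq_zero_iff (by omega)] at hz
  rcases hz with hz | hz | hz
  · exact absurd ((map_eq_zero (algebraMap ℚ ℂ)).mp hz) hrn
  · exact Or.inl (Or.inl hz)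
  · exact Or.inr (Or.inr hz)

end PowerSum

/-- The instance for `CyclotomicField m ℚ` with respect to its `ℚ`-algebra structure as a division ring
of characteristic zero, which is the one found by instance search. -/
theorem CyclotomicField.isCyclotomicExtension_rat (m : ℕ) [NeZero m] :
    IsCyclotomicExtension {m} ℚ (CyclotomicField m ℚ) := by
  have := CyclotomicField.isCyclotomicExtension m ℚ
  convert this
  · rfl
  · exact Subsingleton.elim _ _

theorem CyclotomicField.exists_aeval_eq_zero_iff {m : ℕ} [NeZero m] {ζ : ℂ} (hζ : ζ ^ m = 1) :
    ∃ ξ : CyclotomicField m ℚ, ξ ^ m = 1 ∧ ∀ P : ℚ[X], aeval ζ P = 0 ↔ aeval ξ P = 0 := by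
  have := CyclotomicField.isCyclotomicExtension_rat m
  let φ : CyclotomicField m ℚ →ₐ[ℚ] ℂ :=
    (Classical.arbitrary (CyclotomicField m ℚ →+* ℂ)).toRatAlgHom
  have hμ := IsCyclotomicExtension.zeta_spec m ℚ (CyclotomicField m ℚ)
  obtain ⟨i, -, hi⟩ := (hμ.map_of_injective φ.injective).eq_pow_of_pow_eq_one hζ
  refine ⟨IsCyclotomicExtension.zeta m ℚ (CyclotomicField m ℚ) ^ i, ?_, fun P => ?_⟩
  · rw [pow_right_comm, hμ.pow_eq_one, one_pow]
  · have hi' : φ (IsCyclotomicExtension.zeta m ℚ (CyclotomicField m ℚ)) ^ i = ζ := hi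
    rw [← hi', ← map_pow, aeval_algHom_apply φ, map_eq_zero_iff φ φ.injective]

/-! ### Zeros of power sums at roots of unity -/

section Main

variable {c₁ c₂ f₁ f₂ : ℚ[X]} {m : ℕ}

theorem three_add_log_le_heightParam_add_log :
    3 + Real.log (maxDegree c₁ c₂ f₁ f₂) ≤
      heightParam c₁ c₂ f₁ f₂ + Real.log (maxDegree c₁ c₂ f₁ f₂) := by
  gcongr
  exact le_max_left _ _

/-- The height comparison, when `f₂(ξ) / f₁(ξ)` is not a root of unity. -/
theorem le_indexBound_of_forall_pow_ne_one (hm : 3 ≤ m) {K : Type*} [Field K] [NumberField K]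
    [IsCyclotomicExtension {m} ℚ K] {ξ : K} (hξ : ξ ^ m = 1) (h1 : aeval ξ f₁ ≠ 0)
    (h2 : aeval ξ f₂ ≠ 0) (h4 : aeval ξ c₂ ≠ 0) {n : ℕ}
    (hn : aeval ξ (powerSum c₁ c₂ f₁ f₂ n) = 0)
    (hx : ∀ N : ℕ, 0 < N → (aeval ξ f₂ / aeval ξ f₁) ^ N ≠ 1) :
    (n : ℝ) ≤ indexBound c₁ c₂ f₁ f₂ m := by
  have : NeZero m := ⟨by omega⟩
  set x := aeval ξ f₂ / aeval ξ f₁ with hxdef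
  set D := maxDegree c₁ c₂ f₁ f₂ with hD
  set Y := heightParam c₁ c₂ f₁ f₂ + Real.log D with hY
  have hpow : -(x ^ n) = aeval ξ c₁ / aeval ξ c₂ := by
    rw [aeval_powerSum] at hn
    rw [hxdef, div_pow]
    field_simp
    linear_combination -hn
  have hup := logHeight₁_aeval_div_aeval_le (g₁ := c₁) (g₂ := c₂) (D := D)
    (by rw [hD, maxDegree]; omega) (by rw [hD, maxDegree]; omega) (by omega) hξ h4
  rw [← hpow, logHeight₁_neg, logHeight₁_pow] at hup
  have hlow := IsCyclotomicExtension.finrank_le_mul_logHeight₁ hm (div_ne_zero h2 h1) hx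
  rw [← hxdef] at hlow
  have hd : (0 : ℝ) < Module.finrank ℚ K := by exact_mod_cast Module.finrank_pos
  have hl2 := Real.log_pos one_lt_two
  have hlog : 0 ≤ Real.log (D : ℝ) := Real.log_natCast_nonneg D
  have hY3 : 3 ≤ Y := by
    have := three_add_log_le_heightParam_add_log (c₁ := c₁) (c₂ := c₂) (f₁ := f₁) (f₂ := f₂)
    rw [← hD] at this
    linarith
  have hlogD : Real.log (D + 1) ≤ Real.log D + Real.log 2 := by
    rcases Nat.eq_zero_or_pos D with h0 | hpos
    · rw [h0]; simp [hl2.le]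
    · have hD1 : (1 : ℝ) ≤ D := by exact_mod_cast hpos
      rw [← Real.log_mul (by positivity) two_ne_zero]
      exact Real.log_le_log (by positivity) (by linarith)
  have hX : pairHeight c₁ c₂ ≤ heightParam c₁ c₂ f₁ f₂ :=
    (le_max_left _ _).trans (le_max_right _ _)
  have hYbound : pairHeight c₁ c₂ + Real.log (D + 1) ≤ Y * (1 + Real.log 2 / 3) := by nlinarith
  have hmL : 0 ≤ (m : ℝ) * Real.log m ^ 3 :=
    mul_nonneg (Nat.cast_nonneg _) (pow_nonneg (Real.log_natCast_nonneg m) 3)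
  have hhpos : 0 < logHeight₁ x := by
    refine lt_of_le_of_ne (zero_le_logHeight₁ x) fun h0 => ?_
    rw [← h0, mul_zero] at hlow
    have : 0 < (1 + Real.log 2 / 3) * (Module.finrank ℚ K : ℝ) := by positivity
    linarith
  refine le_of_mul_le_mul_right ?_ hhpos
  calc (n : ℝ) * logHeight₁ x
      ≤ Module.finrank ℚ K * (pairHeight c₁ c₂ + Real.log (D + 1)) := hup
    _ ≤ Module.finrank ℚ K * (Y * (1 + Real.log 2 / 3)) := by gcongr
    _ = Y * ((1 + Real.log 2 / 3) * Module.finrank ℚ K) := by ring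
    _ ≤ Y * (m * Real.log m ^ 3 * logHeight₁ x) := by gcongr
    _ = indexBound c₁ c₂ f₁ f₂ m * logHeight₁ x := by rw [indexBound, hY]; ring

/-- If the vanishing of `u_k(ζ)` depends only on `k` modulo `N`, then an element `n` of the vanishing
set reduces to its residue `k ∈ [1, N]`, or to `N + k` when `u_k` is identically zero: `u_k` and
`u_{N+k}` cannot both be, since `u_n` is not. -/
theorem exists_mem_vanishingSet_of_forall_add_mul (hc₁ : c₁ ≠ 0) (hf₁ : f₁ ≠ 0) {Z : Set ℂ}
    {N n : ℕ} (hN : 1 ≤ N) (hn : 1 ≤ n) (hn0 : powerSum c₁ c₂ f₁ f₂ n ≠ 0) {ζ : ℂ} (hζ : ζ ∈ Z)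
    (hper : ∀ k j, aeval ζ (powerSum c₁ c₂ f₁ f₂ (k + N * j)) = 0 ↔
      aeval ζ (powerSum c₁ c₂ f₁ f₂ k) = 0)
    (hz : aeval ζ (powerSum c₁ c₂ f₁ f₂ n) = 0) :
    ∃ k, 1 ≤ k ∧ k ≤ N ∧ (k ∈ vanishingSet c₁ c₂ f₁ f₂ Z ∨
      powerSum c₁ c₂ f₁ f₂ k = 0 ∧ N + k ∈ vanishingSet c₁ c₂ f₁ f₂ Z) := by
  have hlt := Nat.mod_lt (n - 1) (show 0 < N by omega)
  have hdiv := Nat.mod_add_div (n - 1) N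
  set k := (n - 1) % N + 1 with hk
  set j := (n - 1) / N
  have hnk : n = k + N * j := by omega
  have hzk : aeval ζ (powerSum c₁ c₂ f₁ f₂ k) = 0 := (hper k j).mp (hnk ▸ hz)
  refine ⟨k, by omega, by omega, ?_⟩
  by_cases hk0 : powerSum c₁ c₂ f₁ f₂ k = 0
  · refine Or.inr ⟨hk0, by omega, fun h => hn0 ?_, ζ, hζ, ?_⟩
    · rw [hnk]
      exact powerSum_add_mul_eq_zero hc₁ hf₁ hk0 (by rwa [add_comm]) j
    · simpa [add_comm] using (hper k 1).mpr hzk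
  · exact Or.inl ⟨by omega, hk0, ζ, hζ, hzk⟩

theorem vanishingSet_trichotomy (hc₁ : c₁ ≠ 0) (hf₁ : f₁ ≠ 0) (hm : 3 ≤ m) {Z : Set ℂ}
    (hZ : ∀ ζ ∈ Z, ζ ^ m = 1) {n : ℕ} (hn : n ∈ vanishingSet c₁ c₂ f₁ f₂ Z) :
    (∃ k ∈ vanishingSet c₁ c₂ f₁ f₂ Z, k ≤ 2 * m) ∨
      (n : ℝ) ≤ indexBound c₁ c₂ f₁ f₂ m ∨
      (Odd m ∧ ∃ k : ℕ, 1 ≤ k ∧ k ≤ 2 * m ∧ powerSum c₁ c₂ f₁ f₂ k = 0 ∧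
        2 * m + k ∈ vanishingSet c₁ c₂ f₁ f₂ Z) := by
  have : NeZero m := ⟨by omega⟩
  have := CyclotomicField.isCyclotomicExtension_rat m
  obtain ⟨hn1, hn0, ζ, hζ, hz⟩ := hn
  obtain ⟨ξ, hξ, hiff⟩ := CyclotomicField.exists_aeval_eq_zero_iff (hZ ζ hζ)
  by_cases hdeg : (aeval ξ c₁ = 0 ∨ aeval ξ f₁ = 0) ∨ (aeval ξ c₂ = 0 ∨ aeval ξ f₂ = 0)
  · obtain ⟨k, hk, hk2⟩ := exists_le_two_mem_vanishingSet hc₁ hf₁ hn1 hn0 hζ fun j hj =>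
      (hiff _).mpr (aeval_powerSum_eq_zero_of_mul_eq_zero ((hiff _).mp hz) hdeg hn1 hj)
    exact Or.inl ⟨k, hk, by omega⟩
  push Not at hdeg
  obtain ⟨⟨h3, h1⟩, h4, h2⟩ := hdeg
  by_cases hx : ∀ N : ℕ, 0 < N → (aeval ξ f₂ / aeval ξ f₁) ^ N ≠ 1
  · exact Or.inr (Or.inl (le_indexBound_of_forall_pow_ne_one hm hξ h1 h2 h4 ((hiff _).mp hz) hx))
  push Not at hx
  obtain ⟨N₀, hN₀, hx⟩ := hx
  have hxN := IsCyclotomicExtension.pow_eq_one_of_pow_eq_one (m := m) hN₀ hx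
  set N := if Even m then m else 2 * m with hNdef
  have hN1 : 1 ≤ N := by rw [hNdef]; split_ifs <;> omega
  have hff : aeval ξ f₂ ^ N = aeval ξ f₁ ^ N := by
    rwa [div_pow, div_eq_one_iff_eq (pow_ne_zero _ h1)] at hxN
  obtain ⟨k, hk1, hkN, hk⟩ := exists_mem_vanishingSet_of_forall_add_mul hc₁ hf₁ hN1 hn1 hn0 hζ
    (fun k j => by
      rw [hiff, hiff, aeval_powerSum, aeval_powerSum, pow_add, pow_add, pow_mul, pow_mul, hff,
        ← mul_assoc, ← mul_assoc, ← add_mul, mul_eq_zero,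
        or_iff_left (pow_ne_zero _ (pow_ne_zero _ h1))]) hz
  rcases Nat.even_or_odd m with he | ho
  · rw [hNdef, if_pos he] at hk hkN
    rcases hk with hk | ⟨-, hk⟩
    · exact Or.inl ⟨k, hk, by omega⟩
    · exact Or.inl ⟨m + k, hk, by omega⟩
  · rw [hNdef, if_neg (Nat.not_even_iff_odd.mpr ho)] at hk hkN
    rcases hk with hk | ⟨hk0, hk⟩
    · exact Or.inl ⟨k, hk, hkN⟩
    · exact Or.inr (Or.inr ⟨ho, k, hk1, hkN, hk0, hk⟩)

theorem eleven_thirds_mul_le_indexBound (hm : 3 ≤ m) : (11 / 3 : ℝ) * m ≤ indexBound c₁ c₂ f₁ f₂ m := by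
  have l3 := Real.log_three_gt_d9
  have hlog3 : Real.log 3 ≤ Real.log m := Real.log_le_log (by norm_num) (by exact_mod_cast hm)
  have hcube : (1.09 : ℝ) ^ 3 ≤ Real.log m ^ 3 := by gcongr; linarith
  have hY := three_add_log_le_heightParam_add_log (c₁ := c₁) (c₂ := c₂) (f₁ := f₁) (f₂ := f₂)
  have hD := Real.log_natCast_nonneg (maxDegree c₁ c₂ f₁ f₂)
  rw [indexBound]
  calc (11 / 3 : ℝ) * m ≤ m * 1.09 ^ 3 * 3 := by nlinarith
    _ ≤ _ := by gcongr; linarith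

theorem four_mul_le_indexBound (hm : 3 ≤ m) (h : 4 ≤ m ∨ 2 ≤ maxDegree c₁ c₂ f₁ f₂) :
    (4 : ℝ) * m ≤ indexBound c₁ c₂ f₁ f₂ m := by
  have l2 := Real.log_two_gt_d9
  have l3 := Real.log_three_gt_d9
  have hY := three_add_log_le_heightParam_add_log (c₁ := c₁) (c₂ := c₂) (f₁ := f₁) (f₂ := f₂)
  have hD := Real.log_natCast_nonneg (maxDegree c₁ c₂ f₁ f₂)
  have hm0 : (0 : ℝ) ≤ m := Nat.cast_nonneg m
  rw [indexBound]
  rcases h with h | h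
  · have hlog4 : Real.log (2 ^ 2) ≤ Real.log m :=
      Real.log_le_log (by norm_num) (by norm_num; exact_mod_cast h)
    rw [Real.log_pow] at hlog4
    push_cast at hlog4
    have hcube : (1.3 : ℝ) ^ 3 ≤ Real.log m ^ 3 := by gcongr; linarith
    calc (4 : ℝ) * m ≤ m * 1.3 ^ 3 * 3 := by nlinarith
      _ ≤ _ := by gcongr; linarith
  · have hlog3 : Real.log 3 ≤ Real.log m := Real.log_le_log (by norm_num) (by exact_mod_cast hm)
    have hcube : (1.09 : ℝ) ^ 3 ≤ Real.log m ^ 3 := by gcongr; linarith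
    have hlogD : Real.log 2 ≤ Real.log (maxDegree c₁ c₂ f₁ f₂) :=
      Real.log_le_log two_pos (by exact_mod_cast h)
    calc (4 : ℝ) * m ≤ m * 1.09 ^ 3 * 3.5 := by nlinarith
      _ ≤ _ := by gcongr; linarith

end Main

theorem theorem1p6 (c₁ c₂ f₁ f₂ : ℚ[X])
    (hc₁ : c₁ ≠ 0) (hc₂ : c₂ ≠ 0) (hf₁ : f₁ ≠ 0) (hf₂ : f₂ ≠ 0)
    (m : ℕ) (hm : 3 ≤ m)
    (Z : Set ℂ) (hZ : Z = {ζ : ℂ | ζ ^ m = 1} ∨ Z = {ζ : ℂ | IsPrimitiveRoot ζ m})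
    (hne : (vanishingSet c₁ c₂ f₁ f₂ Z).Nonempty) :
    (∃ n : ℕ, IsLeast (vanishingSet c₁ c₂ f₁ f₂ Z) n ∧
      (n : ℝ) ≤ indexBound c₁ c₂ f₁ f₂ m) ∧
    ((∃ n ∈ vanishingSet c₁ c₂ f₁ f₂ Z, n ≤ 2 * m) ∨
      (∀ n ∈ vanishingSet c₁ c₂ f₁ f₂ Z, (n : ℝ) ≤ indexBound c₁ c₂ f₁ f₂ m) ∨
      (Odd m ∧ ∃ k : ℕ, 1 ≤ k ∧ k ≤ 2 * m ∧ powerSum c₁ c₂ f₁ f₂ k = 0 ∧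
        2 * m + k ∈ vanishingSet c₁ c₂ f₁ f₂ Z)) := by
  have hZ' : ∀ ζ ∈ Z, ζ ^ m = 1 := by
    rcases hZ with rfl | rfl
    · exact fun ζ hζ => hζ
    · exact fun ζ hζ => IsPrimitiveRoot.pow_eq_one hζ
  constructor
  · have hmem := Nat.sInf_mem hne
    set n := sInf (vanishingSet c₁ c₂ f₁ f₂ Z)
    have hmin : ∀ k ∈ vanishingSet c₁ c₂ f₁ f₂ Z, n ≤ k := fun k hk => Nat.sInf_le hk
    refine ⟨n, ⟨hmem, hmin⟩, ?_⟩
    have hB := eleven_thirds_mul_le_indexBound (c₁ := c₁) (c₂ := c₂) (f₁ := f₁) (f₂ := f₂) hm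
    have small : ∀ k : ℕ, 3 * k ≤ 11 * m → n ≤ k → (n : ℝ) ≤ indexBound c₁ c₂ f₁ f₂ m := by
      intro k hk hnk
      have h1 : (3 : ℝ) * k ≤ 11 * m := by exact_mod_cast hk
      have h2 : (n : ℝ) ≤ k := by exact_mod_cast hnk
      linarith
    rcases vanishingSet_trichotomy hc₁ hf₁ hm hZ' hmem with
      ⟨k, hk, hk2⟩ | hb | ⟨-, k, hk1, hk2, hk0, hk⟩
    · exact small k (by omega) (hmin k hk)
    · exact hb
    -- The element `2 * m + k` is at most `4 * m`, which exceeds the bound only for `m = 3` and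
    -- `D ≤ 1`; then `11 = 2 * m + 5` is still below it.
    · by_cases h4 : 4 ≤ m ∨ 2 ≤ maxDegree c₁ c₂ f₁ f₂
      · have h := four_mul_le_indexBound hm h4
        have h2 : n ≤ 4 * m := (hmin _ hk).trans (by omega)
        have h3 : (n : ℝ) ≤ 4 * m := by exact_mod_cast h2
        exact h3.trans h
      · push Not at h4
        by_cases hk6 : k ≤ 5
        · exact small _ (by omega) (hmin _ hk)
        · have hD := h4.2
          rw [maxDegree] at hD
          obtain ⟨j, hj, hj2⟩ := exists_le_two_mem_vanishingSet_of_natDegree_lt hc₁ hc₂ hf₁ hf₂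
            (by omega) (by omega) hk0 hmem
          exact small j (by omega) (hmin j hj)
  · by_cases hall : ∀ n ∈ vanishingSet c₁ c₂ f₁ f₂ Z, (n : ℝ) ≤ indexBound c₁ c₂ f₁ f₂ m
    · exact Or.inr (Or.inl hall)
    · push Not at hall
      obtain ⟨n, hn, hlt⟩ := hall
      rcases vanishingSet_trichotomy hc₁ hf₁ hm hZ' hn with h | h | h
      · exact Or.inl h
      · exact absurd h (not_le.mpr hlt)
      · exact Or.inr (Or.inr h)
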